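/- Let $k$ be a field, $P$ a finite poset and $\mathcal D$ the category of pointwise finite dimensional $k$-representations of $P$ (functors from $P$ to finite dimensional $k$-vector spaces). Let $\mathrm{ind}(\mathcal D)$ be the set of isomorphism classes of indecomposable objects of $\mathcal D$, and $\mathrm{Int}(P)\subseteq \mathrm{ind}(\mathcal D)$ the set of classes of the interval representations $k_I$, where $I\subseteq P$ is nonempty, connected and convex ($k_I(x)=k$ for $x\in I$ and $0$ otherwise, with identity maps within $I$ and zero maps elsewhere). For $Q\subseteq\mathrm{ind}(\mathcal D)$ let $\operatorname{add}Q$ be the smallest full additive subcategory of $\mathcal D$ that contains $Q$ and is closed under direct summands (and isomorphisms). An $\operatorname{add}Q$-*cover* of $M$ is a morphism $f:C\to M$ with $C\in\operatorname{add}Q$ such that every morphism $C'\to M$ with $C'\in \operatorname{add}Q$ factors through $f$, and every endomorphism $h$ of $C$ with $fh=f$ is an automorphism. A *minimal $\operatorname{add}Q$-resolution* of $M$ is a sequence of short exact sequences $0\to\Omega^{i+1}\to J_i\to\Omega^i\to0$ ($i\ge0$) with $\Omega^0=M$, in which each $J_i\to\Omega^i$ is an $\operatorname{add}Q$-cover.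 The $\operatorname{add}Q$-*dimension* of $M$ is the least $m\in\mathbb N$ such that $J_\ell=0$ for all $\ell>m$ in a minimal $\operatorname{add}Q$-resolution of $M$ (and $\infty$ if there is none), and the *global $\operatorname{add}Q$-dimension* of $\mathcal D$ is the supremum of the $\operatorname{add}Q$-dimensions of all $M\in\mathcal D$. The split Grothendieck group $K^{\mathrm{sp}}(\mathcal D)$ is the free abelian group on the isomorphism classes of objects of $\mathcal D$ modulo the relations $[M\oplus N]=[M]+[N]$. The Grothendieck group $K(\mathcal D,Q)$ relative to $Q$ is the quotient of $K^{\mathrm{sp}}(\mathcal D)$ by the relations $[M]=[L]+[N]$ for all short exact sequences $0\to L\to M\to N\to0$ in $\mathcal D$ that stay exact under $\operatorname{Hom}(C,-)$ for every $C\in\operatorname{add}Q$. An *additive invariant* is a homomorphism $f$ from $K^{\mathrm{sp}}(\mathcal D)$ to some abelian group; it is *finer* than an additive invariant $g$ if $\ker f\subseteq\ker g$, *equivalent* to $g$ if $\ker f=\ker g$, and *strictly finer* than $g$ if $\ker f\subsetneq\ker g$. It is *homological relative to $Q$* if it is equivalent to the canonical quotient map $K^{\mathrm{sp}}(\mathcal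 D)\to K(\mathcal D,Q)$. **Theorem (hierarchy of homological invariants).** Let $\mathrm{Int}(P)\subseteq Q_1\subsetneq Q_2\subseteq\mathrm{ind}(\mathcal D)$, and suppose that the global $\operatorname{add}Q_1$-dimension and the global $\operatorname{add}Q_2$-dimension of $\mathcal D$ are both finite. Then every additive invariant that is homological relative to $Q_2$ is strictly finer than every additive invariant that is homological relative to $Q_1$. -/

import Mathlib

open CategoryTheory CategoryTheory.Limits

universe w u v w₁ w₂

noncomputable section

namespace RelHom

/-! ## Additive invariants of an abelian category and their comparison -/

section Category

variable (D : Type u) [Category.{v} D]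

/-- The isomorphism classes of objects of `D`. -/
abbrev IsoClass : Type u := Quotient (isIsomorphicSetoid D)

variable {D}

/-- The isomorphism class `[M]` of an object `M`. -/
def cls (M : D) : IsoClass D := Quotient.mk (isIsomorphicSetoid D) M

variable [Abelian D]

variable (D) in
/-- `ind(D)`: the set of isomorphism classes of indecomposable objects of `D`. -/
def indClasses : Set (IsoClass D) := {c | ∃ M : D, Indecomposable M ∧ c = cls M}

variable (D) in
/-- The subgroup generated by the elements `[M ⊞ N] - ([M] + [N])`. -/
def splitRelations : AddSubgroup (FreeAbelianGroup (IsoClass D)) :=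
  AddSubgroup.closure {x | ∃ M N : D,
    x = FreeAbelianGroup.of (cls (M ⊞ N)) -
      (FreeAbelianGroup.of (cls M) + FreeAbelianGroup.of (cls N))}

variable (D) in
/-- The split Grothendieck group of `D`. -/
abbrev KSplit : Type u := FreeAbelianGroup (IsoClass D) ⧸ splitRelations D

/-- The class of an object in the split Grothendieck group. -/
def kcls (M : D) : KSplit D :=
  QuotientAddGroup.mk' (splitRelations D) (FreeAbelianGroup.of (cls M))

/-- For additive invariants (homomorphisms from the split Grothendieck group to abelian groups):
`f` is finer than `g` if `ker f ⊆ ker g`. -/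
def Finer {G : Type w₁} {H : Type w₂} [AddCommGroup G] [AddCommGroup H]
    (f : KSplit D →+ G) (g : KSplit D →+ H) : Prop :=
  f.ker ≤ g.ker

/-- `f` and `g` are equivalent (have equal discriminating power). -/
def Equivalent {G : Type w₁} {H : Type w₂} [AddCommGroup G] [AddCommGroup H]
    (f : KSplit D →+ G) (g : KSplit D →+ H) : Prop :=
  Finer f g ∧ Finer g f

/-- `f` is strictly finer than `g`: finer, and not equivalent. -/
def StrictlyFiner {G : Type w₁} {H : Type w₂} [AddCommGroup G] [AddCommGroup H]
    (f : KSplit D →+ G) (g : KSplit D →+ H) : Prop :=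
  Finer f g ∧ ¬ Equivalent f g

/-! ## Relative homological algebra -/

/-- `add Q`: the smallest class of objects that contains the objects whose isomorphism class is
in `Q` and the zero objects, and is closed under direct sums and direct summands
(so also under isomorphisms). -/
inductive AddClosure (Q : Set (IsoClass D)) : D → Prop
  | of (M : D) (h : cls M ∈ Q) : AddClosure Q M
  | zero (M : D) (h : IsZero M) : AddClosure Q M
  | biprod (M N : D) (hM : AddClosure Q M) (hN : AddClosure Q N) : AddClosure Q (M ⊞ N)
  | summand (M N L : D) (e : L ≅ M ⊞ N) (hL : AddClosure Q L) : AddClosure Q M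

/-- `f : C ⟶ M` is an `add Q`-cover (a right minimal `add Q`-approximation) of `M`. -/
structure IsCover (Q : Set (IsoClass D)) {C M : D} (f : C ⟶ M) : Prop where
  mem : AddClosure Q C
  lift : ∀ (C' : D), AddClosure Q C' → ∀ f' : C' ⟶ M, ∃ h : C' ⟶ C, h ≫ f = f'
  minimal : ∀ h : C ⟶ C, h ≫ f = f → IsIso h

/-- A minimal `add Q`-resolution of `M`, given by its syzygies `Ω i`, with `Ω 0` being `M`
(up to isomorphism), and by short exact sequences `0 ⟶ Ω (i+1) ⟶ J i ⟶ Ω i ⟶ 0` in which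
`J i ⟶ Ω i` is an `add Q`-cover. -/
structure MinimalResolution (Q : Set (IsoClass D)) (M : D) where
  Ω : ℕ → D
  aug : Ω 0 ≅ M
  J : ℕ → D
  ι : ∀ i, Ω (i + 1) ⟶ J i
  f : ∀ i, J i ⟶ Ω i
  w : ∀ i, ι i ≫ f i = 0
  shortExact : ∀ i, (ShortComplex.mk (ι i) (f i) (w i)).ShortExact
  cover : ∀ i, IsCover Q (f i)

/-- The `add Q`-dimension of `M`: the least `m` such that `J l = 0` for all `l > m` in a minimal
`add Q`-resolution of `M`; it is infinite if there is no such `m` or no such resolution. -/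
def relDim (Q : Set (IsoClass D)) (M : D) : ℕ∞ :=
  ⨅ (R : MinimalResolution Q M) (m : ℕ) (_ : ∀ l, m < l → IsZero (R.J l)), (m : ℕ∞)

variable (D) in
/-- The global `add Q`-dimension of `D`. -/
def globalRelDim (Q : Set (IsoClass D)) : ℕ∞ := ⨆ M : D, relDim Q M

/-- A short exact sequence is `add Q`-exact if it stays exact under `Hom(C, -)` for all `C` in
`add Q`, that is, if all morphisms from `C` to its last term lift to its middle term. -/
def RelExact (Q : Set (IsoClass D)) (S : ShortComplex D) : Prop :=
  S.ShortExact ∧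
    ∀ C : D, AddClosure Q C → ∀ h : C ⟶ S.X₃, ∃ h' : C ⟶ S.X₂, h' ≫ S.g = h

/-- The subgroup of the split Grothendieck group generated by the elements `[M] - ([L] + [N])`
for the `add Q`-exact sequences `0 ⟶ L ⟶ M ⟶ N ⟶ 0`. -/
def relRelations (Q : Set (IsoClass D)) : AddSubgroup (KSplit D) :=
  AddSubgroup.closure {x | ∃ S : ShortComplex D, RelExact Q S ∧
    x = kcls S.X₂ - (kcls S.X₁ + kcls S.X₃)}

/-- The Grothendieck group of `D` relative to `Q`. -/
abbrev KRel (Q : Set (IsoClass D)) : Type u := KSplit D ⧸ relRelations Q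

/-- The canonical quotient map from the split to the relative Grothendieck group. -/
def toKRel (Q : Set (IsoClass D)) : KSplit D →+ KRel Q := QuotientAddGroup.mk' (relRelations Q)

/-- An additive invariant is homological relative to `Q` if it is equivalent to the canonical
quotient map to the Grothendieck group relative to `Q`. -/
def IsHomological (Q : Set (IsoClass D)) {G : Type w} [AddCommGroup G]
    (f : KSplit D →+ G) : Prop :=
  Equivalent f (toKRel Q)

end Category

/-! ## Representations of posets -/

section Poset

variable (k : Type v) [Field k] (P : Type u) [PartialOrder P]

/-- The category of pointwise finite dimensional `k`-representations of `P`: functors from `P`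
to finite dimensional `k`-vector spaces. -/
abbrev PfdRep : Type _ := P ⥤ FGModuleCat.{v} k

variable {P}

/-- Intervals: nonempty, connected and convex subsets of a poset. -/
structure IsPosetInterval (I : Set P) : Prop where
  nonempty : I.Nonempty
  connected : ∀ x ∈ I, ∀ y ∈ I,
    Relation.ReflTransGen (fun a b => a ∈ I ∧ b ∈ I ∧ (a ≤ b ∨ b ≤ a)) x y
  convex : ∀ x ∈ I, ∀ z ∈ I, ∀ y, x ≤ y → y ≤ z → y ∈ I

/-- The space of the interval representation at `x`: the functions from the proofs of `x ∈ I`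
to `k`, a copy of `k` if `x ∈ I` and zero otherwise. -/
abbrev intervalSpace (I : Set P) (x : P) : Type v := PLift (x ∈ I) → k

open Classical in
/-- The map from the space at `x` to the space at `y`: the identity of `k` if both `x` and `y` are
in `I`, and zero otherwise. -/
def intervalMap (I : Set P) (x y : P) : intervalSpace k I x →ₗ[k] intervalSpace k I y where
  toFun c := fun _ => if h : x ∈ I then c ⟨h⟩ else 0
  map_add' a b := by
    funext i
    by_cases h : x ∈ I <;> simp [h]
  map_smul' r a := by
    funext i
    by_cases h : x ∈ I <;> simp [h]

/-- The interval representation with support `I`. -/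
def intervalRep (I : Set P) (hI : IsPosetInterval I) : PfdRep k P where
  obj x := FGModuleCat.of k (intervalSpace k I x)
  map {x y} _ := FGModuleCat.ofHom (intervalMap k I x y)
  map_id x := by
    refine FGModuleCat.hom_ext (LinearMap.ext fun c => funext fun i => ?_)
    exact dif_pos i.down
  map_comp {x y z} f g := by
    classical
    refine FGModuleCat.hom_ext (LinearMap.ext fun c => funext fun i => ?_)
    change (if h : x ∈ I then c ⟨h⟩ else 0) =
      if _ : y ∈ I then (if h : x ∈ I then c ⟨h⟩ else 0) else 0
    by_cases hx : x ∈ I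
    · have hy : y ∈ I := hI.convex x hx z i.down y (leOfHom f) (leOfHom g)
      simp [hy]
    · simp [hx]

variable (P) in
/-- `Int(P)`: the set of isomorphism classes of interval representations. -/
def intClasses : Set (IsoClass (PfdRep k P)) :=
  {c | ∃ (I : Set P) (hI : IsPosetInterval I), c = cls (intervalRep k I hI)}

end Poset

end RelHom

end

/-! An invariant is homological relative to `Q` exactly when its kernel is `relRelations Q`, so the
claim is that `relRelations Q₂` lies strictly inside `relRelations Q₁`. The inclusion holds because
testing exactness against more objects leaves fewer exact sequences.

For strictness, take an indecomposable `M` with class in `Q₂` but not in `Q₁`. Finite global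
dimension relative to `Q₁` supplies a short exact sequence 0 → Ω → J → M → 0 whose right map is an
`add Q₁`-cover; its relation lies in `relRelations Q₁`. The invariant dim Hom(M, -) vanishes on
`relRelations Q₂` (`relRelations_le_ker_homDim`). If the relation also lay there, a dimension count
would make Hom(M, J) → Hom(M, M) surjective (`exists_lift_of_mem_relRelations`), and M would be a
retract of J. By a Krull–Schmidt argument (`AddClosure.cls_mem_of_retract`) the class of M would
then be in `Q₁`, a contradiction. -/

noncomputable section

namespace RelHom

/-! ### Fitting's lemma for finite-dimensional algebras -/

section Fitting

/-- An element of a finite-dimensional algebra without nontrivial idempotents is invertible or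
nilpotent. -/
theorem isUnit_or_isNilpotent_of_idempotents_trivial {k A : Type*} [Field k] [Ring A] [Algebra k A]
    [Module.Finite k A] (hA : ∀ e : A, e * e = e → e = 0 ∨ e = 1) (a : A) :
    IsUnit a ∨ IsNilpotent a := by
  have hint : IsIntegral k a := Algebra.IsIntegral.isIntegral a
  have hne : minpoly k a ≠ 0 := minpoly.ne_zero hint
  obtain ⟨q, hq, hndvd⟩ := Polynomial.exists_eq_pow_rootMultiplicity_mul_and_not_dvd _ hne 0
  set m := (minpoly k a).rootMultiplicity 0
  simp only [map_zero, sub_zero] at hq hndvd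
  -- The minimal polynomial is X ^ m * q with q prime to X. The exponent m + 1 rather than m leaves
  -- a factor `a` in the idempotent `e` below even when m = 0, from which an inverse of `a` is read
  -- off if e = 1.
  have hcop : IsCoprime ((Polynomial.X : Polynomial k) ^ (m + 1)) q :=
    ((Polynomial.irreducible_X.coprime_iff_not_dvd).2 hndvd).pow_left
  obtain ⟨s, t, hst⟩ := hcop
  have hzero : a ^ m * Polynomial.aeval a q = 0 := by
    have := minpoly.aeval k a
    rwa [hq, map_mul, map_pow, Polynomial.aeval_X] at this
  have hsum : Polynomial.aeval a s * a ^ (m + 1) + Polynomial.aeval a (t * q) = 1 := by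
    simpa using congrArg (Polynomial.aeval a) hst
  have hprod : Polynomial.aeval a s * a ^ (m + 1) * Polynomial.aeval a (t * q) = 0 := by
    have : s * Polynomial.X ^ (m + 1) * (t * q) = s * t * Polynomial.X * minpoly k a := by
      rw [hq]; ring
    have h := congrArg (Polynomial.aeval a) this
    rw [map_mul _ _ (minpoly k a), minpoly.aeval, mul_zero] at h
    simpa using h
  set e := Polynomial.aeval a s * a ^ (m + 1) with he
  have hidem : e * e = e := by
    have h : e * (e + Polynomial.aeval a (t * q)) = e := by rw [hsum, mul_one]
    rwa [mul_add, hprod, add_zero] at h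
  rcases hA e hidem with h0 | h1
  · right
    refine ⟨m, ?_⟩
    rw [h0, zero_add] at hsum
    rw [← mul_one (a ^ m), ← hsum, mul_comm t q, map_mul, ← mul_assoc, hzero, zero_mul]
  · left
    have hcomm : a * (Polynomial.aeval a s * a ^ m) = Polynomial.aeval a s * a ^ m * a := by
      have : Polynomial.X * (s * Polynomial.X ^ m) = s * Polynomial.X ^ m * Polynomial.X := by ring
      simpa using congrArg (Polynomial.aeval a) this
    have hl : Polynomial.aeval a s * a ^ m * a = 1 := by
      rw [mul_assoc, ← pow_succ, ← he, h1]
    exact ⟨⟨a, Polynomial.aeval a s * a ^ m, hcomm.trans hl, hl⟩, rfl⟩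

end Fitting

/-! ### Krull–Schmidt arguments, dim Hom(C, -) and relative relations -/

section Category

variable {D : Type u} [Category.{v} D] [Abelian D]

theorem Indecomposable.idempotent_trivial {M : D} (hM : Indecomposable M) (e : M ⟶ M)
    (he : e ≫ e = e) : e = 0 ∨ e = 𝟙 M := by
  obtain ⟨Y, i, p, hip, hpi⟩ := IsIdempotentComplete.idempotents_split M e he
  obtain ⟨Z, j, q, hjq, hqj⟩ := IsIdempotentComplete.idempotents_split M (𝟙 M - e)
    (Idempotents.idem_of_id_sub_idem e he)
  have hiq : i ≫ q = 0 := by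
    have : i ≫ (q ≫ j) = 0 := by
      rw [hqj, ← hpi, Preadditive.comp_sub, reassoc_of% hip]; simp
    rw [← Category.comp_id q, ← hjq, reassoc_of% this, zero_comp]
  have hjp : j ≫ p = 0 := by
    have : j ≫ (p ≫ i) = 0 := by
      have h : j ≫ (q ≫ j) = j := by rw [reassoc_of% hjq]
      rw [hqj, Preadditive.comp_sub, Category.comp_id] at h
      rw [hpi]; simpa using h
    rw [← Category.comp_id p, ← hip, reassoc_of% this, zero_comp]
  let φ : M ≅ Y ⊞ Z :=
    { hom := biprod.lift p q
      inv := biprod.desc i j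
      hom_inv_id := by rw [biprod.lift_desc, hpi, hqj]; abel
      inv_hom_id := by ext <;> simp [hip, hjq, hiq, hjp] }
  rcases hM.2 Y Z φ with h | h
  · left; rw [← hpi, h.eq_of_tgt p 0, zero_comp]
  · right
    have : 𝟙 M - e = 0 := by rw [← hqj, h.eq_of_tgt q 0, zero_comp]
    exact (sub_eq_zero.1 this).symm

/-- The idempotent of `X` given by the retraction is 0 or 1, and 0 would force `M` to vanish. -/
theorem Indecomposable.iso_of_retract {M X : D} (hM : Indecomposable M) (hX : Indecomposable X)
    (h : Retract M X) : Nonempty (M ≅ X) := by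
  rcases Indecomposable.idempotent_trivial hX (h.r ≫ h.i) (by simp) with h0 | h1
  · refine (hM.1 ((IsZero.iff_id_eq_zero M).2 ?_)).elim
    calc 𝟙 M = h.i ≫ (h.r ≫ h.i) ≫ h.r := by simp
      _ = 0 := by rw [h0]; simp
  · exact ⟨⟨h.i, h.r, h.retract, h1⟩⟩

variable (k : Type w) [Field k] [Linear k D] [∀ X Y : D, Module.Finite k (X ⟶ Y)]

include k in
/-- The endomorphism ring of an indecomposable object is local. -/
theorem Indecomposable.isIso_or_isIso_of_add_eq_id {M : D} (hM : Indecomposable M) (a b : M ⟶ M)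
    (hab : a + b = 𝟙 M) : IsIso a ∨ IsIso b := by
  have : Module.Finite k (End M) := inferInstanceAs (Module.Finite k (M ⟶ M))
  rcases isUnit_or_isNilpotent_of_idempotents_trivial (k := k) (A := End M)
    (fun e he => Indecomposable.idempotent_trivial hM e he) a with h | h
  · exact Or.inl ((isUnit_iff_isIso a).1 h)
  · have hb : b = 𝟙 M - a := eq_sub_of_add_eq' hab
    exact Or.inr ((isUnit_iff_isIso b).1 (by rw [hb]; exact h.isUnit_one_sub))

include k in
/-- An indecomposable summand of an object of `add Q` is isomorphic to a member of `Q`. -/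
theorem AddClosure.cls_mem_of_retract {Q : Set (IsoClass D)} (hQ : Q ⊆ indClasses D) {X : D}
    (hX : AddClosure Q X) {M : D} (hM : Indecomposable M) (h : Retract M X) : cls M ∈ Q := by
  induction hX generalizing M with
  | of X hX =>
    obtain ⟨X', hX', he⟩ := hQ hX
    obtain ⟨φ⟩ : Nonempty (X ≅ X') := Quotient.exact he
    obtain ⟨ψ⟩ := Indecomposable.iso_of_retract hM hX' (h.trans (.ofIso φ))
    have : cls M = cls X := (Quotient.sound ⟨ψ⟩ : cls M = cls X').trans he.symm
    rwa [this]
  | zero X hX =>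
    refine (hM.1 ((IsZero.iff_id_eq_zero M).2 ?_)).elim
    rw [← h.retract, hX.eq_of_tgt h.i 0, zero_comp]
  | biprod A B _ _ ihA ihB =>
    -- The identity of `M` splits into a part through `A` and a part through `B`. As the
    -- endomorphism ring is local, one part is invertible, so `M` is a retract of that summand.
    have hsum : (h.i ≫ biprod.fst) ≫ (biprod.inl ≫ h.r) +
        (h.i ≫ biprod.snd) ≫ (biprod.inr ≫ h.r) = 𝟙 M := by
      calc _ = h.i ≫ (biprod.fst ≫ biprod.inl + biprod.snd ≫ biprod.inr) ≫ h.r := by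
            simp only [Category.assoc, Preadditive.add_comp, Preadditive.comp_add]
        _ = 𝟙 M := by rw [biprod.total]; simp
    rcases Indecomposable.isIso_or_isIso_of_add_eq_id k hM _ _ hsum with hi | hi
    · exact ihA hM ⟨h.i ≫ biprod.fst,
        (biprod.inl ≫ h.r) ≫ inv ((h.i ≫ biprod.fst) ≫ (biprod.inl ≫ h.r)), by
          rw [← Category.assoc, IsIso.hom_inv_id]⟩
    · exact ihB hM ⟨h.i ≫ biprod.snd,
        (biprod.inr ≫ h.r) ≫ inv ((h.i ≫ biprod.snd) ≫ (biprod.inr ≫ h.r)), by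
          rw [← Category.assoc, IsIso.hom_inv_id]⟩
  | summand A B L e _ ih =>
    exact ih hM (h.trans ⟨biprod.inl ≫ e.inv, e.hom ≫ biprod.fst, by simp⟩)

/-- The additive invariant `dim Hom(C, -)`. -/
def homDim (C : D) : KSplit D →+ ℤ :=
  QuotientAddGroup.lift (splitRelations D)
    (FreeAbelianGroup.lift (Quotient.lift (fun M : D => (Module.finrank k (C ⟶ M) : ℤ))
      (fun _ _ ⟨e⟩ => by
        exact_mod_cast (Linear.homCongr k (Iso.refl C) e).finrank_eq)))
    ((AddSubgroup.closure_le _).2 (by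
      rintro _ ⟨M, N, rfl⟩
      have key : Module.finrank k (C ⟶ M ⊞ N) =
          Module.finrank k (C ⟶ M) + Module.finrank k (C ⟶ N) := by
        rw [← Module.finrank_prod]
        refine LinearEquiv.finrank_eq (LinearEquiv.ofBijective
          ((Linear.rightComp k C (biprod.fst : M ⊞ N ⟶ M)).prod
            (Linear.rightComp k C (biprod.snd : M ⊞ N ⟶ N))) ⟨fun a b hab => ?_, fun x => ?_⟩)
        · exact biprod.hom_ext _ _ (congrArg Prod.fst hab) (congrArg Prod.snd hab)
        · exact ⟨biprod.lift x.1 x.2, Prod.ext (biprod.lift_fst _ _) (biprod.lift_snd _ _)⟩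
      simp [AddMonoidHom.mem_ker, cls, key]))

theorem homDim_kcls (C M : D) : homDim k C (kcls M) = Module.finrank k (C ⟶ M) := by
  change FreeAbelianGroup.lift _ (FreeAbelianGroup.of (cls M)) = _
  rw [FreeAbelianGroup.lift_apply_of]
  rfl

/-- Left exactness of Hom(C, -) and rank–nullity. Surjectivity of Hom(C, g) thus becomes an equality
of dimensions. -/
theorem finrank_range_rightComp_add (C : D) {S : ShortComplex D} (hS : S.ShortExact) :
    Module.finrank k (LinearMap.range (Linear.rightComp k C S.g)) + Module.finrank k (C ⟶ S.X₁) =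
      Module.finrank k (C ⟶ S.X₂) := by
  rw [← LinearMap.finrank_range_add_finrank_ker (Linear.rightComp k C S.g)]
  have := hS.mono_f
  have hinj : Function.Injective (Linear.rightComp k C S.f) :=
    fun a b hab => (cancel_mono S.f).1 hab
  have hker : LinearMap.range (Linear.rightComp k C S.f) =
      LinearMap.ker (Linear.rightComp k C S.g) := by
    ext x
    constructor
    · rintro ⟨y, rfl⟩
      simp [LinearMap.mem_ker]
    · intro hx
      exact ⟨hS.exact.lift x hx, hS.exact.lift_f x hx⟩
  rw [← hker, LinearMap.finrank_range_of_inj hinj]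

theorem relRelations_le_ker_homDim {Q : Set (IsoClass D)} {C : D} (hC : AddClosure Q C) :
    relRelations Q ≤ (homDim k C).ker := by
  refine (AddSubgroup.closure_le _).2 ?_
  rintro _ ⟨S, ⟨hS, hlift⟩, rfl⟩
  have hr : LinearMap.range (Linear.rightComp k C S.g) = ⊤ :=
    LinearMap.range_eq_top.2 fun x => hlift C hC x
  have h := finrank_range_rightComp_add k C hS
  rw [hr, finrank_top] at h
  simp [AddMonoidHom.mem_ker, homDim_kcls, ← h, add_comm]

include k in
/-- A short exact sequence whose relation holds in the Grothendieck group relative to `Q` stays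
exact under `Hom(C, -)` for `C` in `add Q`. -/
theorem exists_lift_of_mem_relRelations {Q : Set (IsoClass D)} {C : D} (hC : AddClosure Q C)
    {S : ShortComplex D} (hS : S.ShortExact)
    (hmem : kcls S.X₂ - (kcls S.X₁ + kcls S.X₃) ∈ relRelations Q) (h : C ⟶ S.X₃) :
    ∃ h' : C ⟶ S.X₂, h' ≫ S.g = h := by
  have h0 := relRelations_le_ker_homDim k hC hmem
  rw [AddMonoidHom.mem_ker, map_sub, map_add, homDim_kcls, homDim_kcls, homDim_kcls] at h0
  have h1 := finrank_range_rightComp_add k C hS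
  -- By `h0` dim Hom(C, -) is additive on the sequence, so by `h1` the range has the full dimension
  -- of Hom(C, X₃).
  have hr : LinearMap.range (Linear.rightComp k C S.g) = ⊤ :=
    Submodule.eq_top_of_finrank_eq (by omega)
  exact LinearMap.range_eq_top.1 hr h

theorem AddClosure.mono {Q₁ Q₂ : Set (IsoClass D)} (h : Q₁ ⊆ Q₂) {M : D}
    (hM : AddClosure Q₁ M) : AddClosure Q₂ M := by
  induction hM with
  | of M hM => exact .of M (h hM)
  | zero M hM => exact .zero M hM
  | biprod M N _ _ ihM ihN => exact .biprod M N ihM ihN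
  | summand M N L e _ ih => exact .summand M N L e ih

theorem relRelations_antitone {Q₁ Q₂ : Set (IsoClass D)} (h : Q₁ ⊆ Q₂) :
    relRelations Q₂ ≤ relRelations Q₁ :=
  AddSubgroup.closure_mono fun _ ⟨S, ⟨hS, hl⟩, hx⟩ =>
    ⟨S, ⟨hS, fun C hC => hl C (hC.mono h)⟩, hx⟩

theorem isHomological_iff_ker_eq {Q : Set (IsoClass D)} {G : Type*} [AddCommGroup G]
    {f : KSplit D →+ G} : IsHomological Q f ↔ f.ker = relRelations Q := by
  have : (toKRel Q).ker = relRelations Q := QuotientAddGroup.ker_mk' _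
  rw [IsHomological, Equivalent, Finer, Finer, this]
  exact ⟨fun h => le_antisymm h.1 h.2, fun h => ⟨h.le, h.ge⟩⟩

theorem nonempty_minimalResolution {Q : Set (IsoClass D)} (h : globalRelDim D Q < ⊤) (M : D) :
    Nonempty (MinimalResolution Q M) := by
  by_contra hM
  rw [not_nonempty_iff] at hM
  refine (lt_of_le_of_lt (le_iSup (relDim Q) M) h).ne ?_
  -- An infimum over an empty type of resolutions is ⊤.
  simp [relDim]

include k in
/-- If the global `add Q₁`-dimension is finite, enlarging `Q₁` within `ind(D)` strictly shrinks
the relations of the relative Grothendieck group. -/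
theorem not_relRelations_le {Q₁ Q₂ : Set (IsoClass D)} (h12 : Q₁ ⊂ Q₂)
    (hind : Q₂ ⊆ indClasses D) (hdim : globalRelDim D Q₁ < ⊤) :
    ¬ relRelations Q₁ ≤ relRelations Q₂ := by
  intro hle
  obtain ⟨c, hc₂, hc₁⟩ := Set.exists_of_ssubset h12
  obtain ⟨M, hM, rfl⟩ := hind hc₂
  obtain ⟨R⟩ := nonempty_minimalResolution hdim M
  have hmem : kcls (R.J 0) - (kcls (R.Ω 1) + kcls (R.Ω 0)) ∈ relRelations Q₁ :=
    AddSubgroup.subset_closure ⟨_, ⟨R.shortExact 0, (R.cover 0).lift⟩, rfl⟩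
  -- The lifted map is the identity of `M`, up to the identification of `Ω 0` with `M`.
  obtain ⟨s, hs⟩ := exists_lift_of_mem_relRelations k (.of M hc₂) (R.shortExact 0) (hle hmem)
    R.aug.inv
  exact hc₁ ((R.cover 0).mem.cls_mem_of_retract k (h12.subset.trans hind) hM
    ⟨s, R.f 0 ≫ R.aug.hom, by
      change s ≫ R.f 0 = _ at hs
      rw [reassoc_of% hs, Iso.inv_hom_id]⟩)

end Category

section Poset

/-- A morphism is determined by its components, finitely many elements of finite-dimensional Hom
spaces. -/
instance finite_hom_pfdRep (k : Type v) [Field k] {P : Type u} [PartialOrder P] [Finite P]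
    (X Y : PfdRep k P) : Module.Finite k (X ⟶ Y) :=
  Module.Finite.of_injective
    (LinearMap.pi fun x => NatTrans.appLinearMap (F := X) (G := Y) (R := k) x)
    fun _ _ h => NatTrans.ext h

end Poset

end RelHom

end

theorem mainTheorem10 {k : Type v} [Field k] {P : Type u} [PartialOrder P] [Finite P]
    (Q₁ Q₂ : Set (RelHom.IsoClass (RelHom.PfdRep k P)))
    (hInt : RelHom.intClasses k P ⊆ Q₁) (h12 : Q₁ ⊂ Q₂)
    (hind : Q₂ ⊆ RelHom.indClasses (RelHom.PfdRep k P))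
    (hdim₁ : RelHom.globalRelDim (RelHom.PfdRep k P) Q₁ < ⊤)
    (hdim₂ : RelHom.globalRelDim (RelHom.PfdRep k P) Q₂ < ⊤)
    {G₁ : Type w₁} {G₂ : Type w₂} [AddCommGroup G₁] [AddCommGroup G₂]
    (f : RelHom.KSplit (RelHom.PfdRep k P) →+ G₁)
    (g : RelHom.KSplit (RelHom.PfdRep k P) →+ G₂)
    (hf : RelHom.IsHomological Q₁ f) (hg : RelHom.IsHomological Q₂ g) :
    RelHom.StrictlyFiner g f := by
  rw [RelHom.isHomological_iff_ker_eq] at hf hg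
  refine ⟨?_, fun h => RelHom.not_relRelations_le k h12 hind hdim₁ ?_⟩
  · rw [RelHom.Finer, hf, hg]
    exact RelHom.relRelations_antitone h12.subset
  · have h' := h.2
    rwa [RelHom.Finer, hf, hg] at h'
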